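/- Let $K$ be a field with a nonarchimedean valuation $\nu : K \to \mathbb{R}\cup\{\infty\}$ (possibly trivial), and let $V$ be a finite-dimensional $K$-vector space equipped with one of the following: 1. a symplectic form $b$, i.e. a nondegenerate alternating bilinear form; 2. a nondegenerate quadratic form $q$ with associated bilinear form $b(x,y)=q(x+y)-q(x)-q(y)$, where nondegenerate means that no $x\neq 0$ satisfies both $q(x)=0$ and $b(x,\cdot)=0$; 3. a nondegenerate Hermitian form $b$ with respect to an automorphism $a\mapsto\overline a$ of $K$ of order exactly two with $\nu(\overline a)=\nu(a)$ for all $a$ (so $b$ is biadditive, $b(\alpha x,\beta y)=\alpha\overline\beta\, b(x,y)$ and $b(x,y)=\overline{b(y,x)}$), and $\dim V$ is even. A subspace is isotropic if $b$ vanishes identically on it (in case 2: if $q$ vanishes on it); the Witt index of $V$ is the largest dimension of an isotropic subspace. Assume that the Witt index is $n=\lfloor \dim V/2\rfloor$. Put $Q(x)=b(x,x)$ in cases 1 and 3 and $Q=q$ in case 2. Let $\{e_1,\dots,e_n,f_1,\dots,f_n\}\cup G$ be a basis of $V$ such that $Q(e_i)=Q(f_i)=0$ and $b(e_i,f_i)=1$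 for all $i$, the planes $H_i=\langle e_i,f_i\rangle$ and the space $W=\langle G\rangle$ are pairwise orthogonal with respect to $b$, and $Q(x)\ne 0$ for all $x\in W\setminus\{0\}$. Let $L$ be a maximal isotropic subspace of $V$. Then $L$ can be represented by an $n\times\dim V$ matrix $M$ whose rows, in the coordinates of this basis, form a basis of $L$; and for every such $M$ the function $$S\mapsto p_S(L)=\nu\bigl(\det M[\{e_i: i\in S\}\cup\{f_i : i\in [n]\setminus S\}]\bigr),\qquad S\subseteq[n],$$ given by the valuations of the maximal minors of $M$ in the indicated columns, is a valuated $\Delta$-matroid. Here a $\Delta$-matroid on $[n]$ is a family $\mathcal F$ of subsets of $[n]$ such that for all $A,B\in\mathcal F$ and $a\in A\,\Delta\, B$ there is $b\in A\,\Delta\, B$ (possibly $b=a$) with $A\,\Delta\,\{a,b\}\in\mathcal F$; and a function $p:2^{[n]}\to\mathbb{R}\cup\{\infty\}$ is a valuated $\Delta$-matroid if every cell of the subdivision it induces, i.e. the projection to $\mathbb{R}^n$ of every lower face of $\operatorname{conv}\{(e_S,p_S) : p_S\neq\infty\}\subset\mathbb{R}^{n+1}$ (where $e_S\in\{0,1\}^n$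 is the indicator vector of $S$), is the convex hull of the indicator vectors of a $\Delta$-matroid. -/

import Mathlib

/-! ### Delta-matroids and induced subdivisions -/

/-- A family `F` of subsets of `[n]` is a Delta-matroid if for `A, B ∈ F` and `a ∈ A Δ B` there is
`b ∈ A Δ B` (possibly `b = a`) such that `A Δ {a, b} ∈ F`. -/
def IsDeltaMatroid {n : ℕ} (F : Set (Finset (Fin n))) : Prop :=
  ∀ A ∈ F, ∀ B ∈ F, ∀ a ∈ symmDiff A B, ∃ b ∈ symmDiff A B, symmDiff A {a, b} ∈ F

/-- The indicator vector `e_S` of `S ⊆ [n]`. -/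
def indicatorVec {n : ℕ} (S : Finset (Fin n)) : Fin n → ℝ :=
  fun i => if i ∈ S then 1 else 0

/-- A Delta-matroid polytope: the convex hull of the indicator vectors of a Delta-matroid. -/
def IsDeltaMatroidPolytope {n : ℕ} (P : Set (Fin n → ℝ)) : Prop :=
  ∃ F : Set (Finset (Fin n)), IsDeltaMatroid F ∧ P = convexHull ℝ (indicatorVec '' F)

/-- The polytope `P_p = conv {(e_S, p_S) : p_S ≠ ∞}`. -/
def liftedPolytope {n : ℕ} (p : Finset (Fin n) → WithTop ℝ) : Set ((Fin n → ℝ) × ℝ) :=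
  convexHull ℝ {z | ∃ (S : Finset (Fin n)) (r : ℝ), p S = (r : WithTop ℝ) ∧ z = (indicatorVec S, r)}

/-- `F` is a lower face of `P`: it is cut out by a supporting hyperplane whose inner normal
`(φ, c)` has positive last coordinate `c`. -/
def IsLowerFace {n : ℕ} (P F : Set ((Fin n → ℝ) × ℝ)) : Prop :=
  F.Nonempty ∧ ∃ (φ : Fin n → ℝ) (c d : ℝ), 0 < c ∧
    (∀ z ∈ P, d ≤ (∑ i, φ i * z.1 i) + c * z.2) ∧
    F = {z ∈ P | (∑ i, φ i * z.1 i) + c * z.2 = d}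

/-- The (nonempty) cells of the subdivision induced by `p`: the projections of the lower faces of
the lifted polytope. -/
def inducedSubdivision {n : ℕ} (p : Finset (Fin n) → WithTop ℝ) : Set (Set (Fin n → ℝ)) :=
  {C | ∃ F, IsLowerFace (liftedPolytope p) F ∧ C = Prod.fst '' F}

/-- A valuated Delta-matroid: every cell of the induced subdivision is a Delta-matroid polytope. -/
def IsValuatedDeltaMatroid {n : ℕ} (p : Finset (Fin n) → WithTop ℝ) : Prop :=
  ∀ C ∈ inducedSubdivision p, IsDeltaMatroidPolytope C

/-! ### Forms and isotropic subspaces -/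

section Forms

variable {K : Type*} [Field K] {V : Type*} [AddCommGroup V] [Module K V]

/-- `b` is Hermitian with respect to `σ`. -/
def IsHermitianForm {σ : K →+* K} (b : V →ₗ[K] V →ₛₗ[σ] K) : Prop :=
  ∀ x y, b x y = σ (b y x)

/-- Nondegeneracy of a quadratic form: no nonzero singular vector lies in the radical of the
associated bilinear form. -/
def IsNondegenerateQuadraticForm (q : QuadraticForm K V) : Prop :=
  ∀ x : V, (∀ y, QuadraticMap.polar q x y = 0) → q x = 0 → x = 0

/-- `W` is isotropic for the form `b`: `b` vanishes on `W × W`. -/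
def IsIsotropicForm (b : V → V → K) (W : Submodule K V) : Prop :=
  ∀ x ∈ W, ∀ y ∈ W, b x y = 0

/-- `W` is isotropic for the quadratic form `q`: `q` vanishes on `W`. -/
def IsIsotropicQuadratic (q : V → K) (W : Submodule K V) : Prop :=
  ∀ x ∈ W, q x = 0

/-- The Witt index: the largest dimension of an isotropic subspace. -/
noncomputable def wittIndex (Iso : Submodule K V → Prop) : ℕ :=
  sSup {d | ∃ W : Submodule K V, Iso W ∧ Module.finrank K W = d}

/-- The index set of a basis `(e_1, …, e_n, f_1, …, f_n) ∪ G` with `G` of size `m`. -/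
abbrev WittIdx (n m : ℕ) : Type := (Fin n ⊕ Fin n) ⊕ Fin m

/-- The index of `e_i`. -/
def eIdx {n m : ℕ} (i : Fin n) : WittIdx n m := Sum.inl (Sum.inl i)

/-- The index of `f_i`. -/
def fIdx {n m : ℕ} (i : Fin n) : WittIdx n m := Sum.inl (Sum.inr i)

/-- The plane `H_i` spanned by `e_i` and `f_i`. -/
def hypPlane {n m : ℕ} (B : Module.Basis (WittIdx n m) K V) (i : Fin n) : Submodule K V :=
  Submodule.span K {B (eIdx i), B (fIdx i)}

/-- The span `W` of the remaining basis vectors `G`. -/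
def anisoPart {n m : ℕ} (B : Module.Basis (WittIdx n m) K V) : Submodule K V :=
  Submodule.span K (Set.range fun k : Fin m => B (Sum.inr k))

/-- The basis `B = (e_1, …, e_n, f_1, …, f_n) ∪ G` is adapted to a Witt decomposition
`V = H_1 ⊕ ⋯ ⊕ H_n ⊕ W`: the summands are pairwise orthogonal for `b`, `W` is anisotropic, and
`Q e_i = Q f_i = 0`, `b e_i f_i = 1`. Here `Q` is `x ↦ b x x` for symplectic and Hermitian forms,
and it is the quadratic form itself, with associated bilinear form `b`, in the quadratic case. -/
structure IsWittBasis {n m : ℕ} (b : V → V → K) (Q : V → K)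
    (B : Module.Basis (WittIdx n m) K V) : Prop where
  e_isotropic : ∀ i, Q (B (eIdx i)) = 0
  f_isotropic : ∀ i, Q (B (fIdx i)) = 0
  pairing : ∀ i, b (B (eIdx i)) (B (fIdx i)) = 1
  planes_orthogonal : ∀ i j, i ≠ j → ∀ x ∈ hypPlane B i, ∀ y ∈ hypPlane B j, b x y = 0
  rest_orthogonal : ∀ i, ∀ x ∈ hypPlane B i, ∀ y ∈ anisoPart B, b x y = 0 ∧ b y x = 0
  rest_anisotropic : ∀ x ∈ anisoPart B, x ≠ 0 → Q x ≠ 0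

/-- The rows of `M`, read in the coordinates given by `B`, form a basis of `L`. -/
def Represents {n m : ℕ} (B : Module.Basis (WittIdx n m) K V) (M : Matrix (Fin n) (WittIdx n m) K)
    (L : Submodule K V) : Prop :=
  LinearIndependent K (fun r : Fin n => ∑ j, M r j • B j) ∧
    Submodule.span K (Set.range fun r : Fin n => ∑ j, M r j • B j) = L

/-- The valuation of the maximal minor of `M` whose `i`-th column is the column of `e_i` if `i ∈ S`
and the column of `f_i` if `i ∉ S`. -/
noncomputable def minorValuation {n m : ℕ} (ν : AddValuation K (WithTop ℝ))
    (M : Matrix (Fin n) (WittIdx n m) K) (S : Finset (Fin n)) : WithTop ℝ :=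
  ν (M.submatrix id (fun i => if i ∈ S then eIdx i else fIdx i)).det

end Forms

/-!
Maximal isotropic subspaces `L` have dimension `n`: if `U` is isotropic and `dim L < dim U`, a
dimension count gives a vector of `U` outside `L` that is orthogonal to `L`
(`exists_notMem_forall_eq_zero_of_finrank_lt`). Hence `L` is the row space of an `n`-rowed matrix.

A cell of the induced subdivision is spanned by the sets `S` that minimize `p S + φ(S)` for a weight
`φ : Fin n → ℝ` (`exists_weight_of_mem_inducedSubdivision`), so the exchange property has to be
shown for these minimizers. Let `A` be one of them. After row operations the columns chosen by `A`
form the identity matrix; let `N` be the matrix of the columns that `A` leaves out in the planes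
`H_i`. Then `p (A Δ T) - p A` is the valuation of the principal minor `N[T]`
(`minorValuation_symmDiff`), and the isotropy of `L` makes `N` symmetric, skew-symmetric or
skew-Hermitian up to signs, or alternating up to a rank one term `-c • g gᵀ` in the quadratic case,
where the anisotropic part has dimension at most one. In each case
`min (ν (N i i) + ν (N j j)) (ν (N i i * N j j - N i j * N j i)) ≤ 2 • ν (N i j)`
for `i ≠ j` (`OffDiagControlled`).

This inequality carries the proof (`OffDiagControlled.exists_pair`). Let `w` be the weight such that
minimality of `A` reads `w(T) ≤ ν N[T]` for all `T`, with equality exactly when `A Δ T` is another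
minimizer. The sets `T` of size one and two give `(w i + w j) / 2 ≤ ν (N i j)`, so every term in the
Leibniz expansion of `N[T]` has valuation at least `w(T)`. If `B` is a minimizer and `a ∈ A Δ B` but
no `A Δ {a, b}` with `b ∈ A Δ B` is a minimizer, then the inequalities for the entries `N a b`,
`b ∈ A Δ B`, are strict, and so is the one for `N[A Δ B]`, a contradiction.
-/

/-! ### Cells of the induced subdivision -/

/-- The face of a convex hull cut out by a supporting hyperplane is the convex hull of the
generators on that hyperplane. -/
theorem convexHull_inter_eq_of_forall_le {E : Type*} [AddCommGroup E] [Module ℝ E] (X : Set E)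
    (f : E →ₗ[ℝ] ℝ) (d : ℝ) (hd : ∀ x ∈ X, d ≤ f x) :
    {z ∈ convexHull ℝ X | f z = d} = convexHull ℝ {x ∈ X | f x = d} := by
  apply Set.Subset.antisymm
  · rintro z ⟨hz, hfz⟩
    obtain ⟨ι, _, w, x, hw0, hw1, hx, rfl⟩ := mem_convexHull_iff_exists_fintype.1 hz
    have hsum : ∑ i, w i * (f (x i) - d) = 0 := by
      simp only [map_sum, map_smul, smul_eq_mul] at hfz
      simp only [mul_sub, Finset.sum_sub_distrib, ← Finset.sum_mul, hw1, hfz]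
      ring
    have hz0 : ∀ i, w i * (f (x i) - d) = 0 := fun i =>
      (Finset.sum_eq_zero_iff_of_nonneg fun i _ =>
        mul_nonneg (hw0 i) (sub_nonneg.2 (hd _ (hx i)))).1 hsum i (Finset.mem_univ i)
    rw [← Finset.sum_filter_ne_zero] at hw1
    rw [← Finset.sum_filter_of_ne (p := fun i => w i ≠ 0)
      (fun i _ hi h0 => hi (by rw [h0, zero_smul]))]
    refine (convex_convexHull ℝ _).sum_mem (fun i _ => hw0 i) hw1 fun i hi => ?_
    have hi' := (Finset.mem_filter.1 hi).2
    exact subset_convexHull ℝ _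
      ⟨hx i, sub_eq_zero.1 ((mul_eq_zero.1 (hz0 i)).resolve_left hi')⟩
  · refine convexHull_min ?_ ?_
    · rintro x ⟨hx, hfx⟩
      exact ⟨subset_convexHull ℝ X hx, hfx⟩
    · exact (convex_convexHull ℝ X).inter (convex_hyperplane f.isLinear d)

theorem sum_mul_indicatorVec {n : ℕ} (φ : Fin n → ℝ) (S : Finset (Fin n)) :
    ∑ i, φ i * indicatorVec S i = ∑ i ∈ S, φ i := by
  simp [indicatorVec, Finset.sum_ite_mem]

/-- Each cell of the induced subdivision is spanned by the sets at which `S ↦ p S + φ(S)` attains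
its minimum, for some weight `φ`. -/
theorem exists_weight_of_mem_inducedSubdivision {n : ℕ} {p : Finset (Fin n) → WithTop ℝ}
    {C : Set (Fin n → ℝ)} (hC : C ∈ inducedSubdivision p) :
    ∃ (φ : Fin n → ℝ) (d : ℝ), (∀ S, (d : WithTop ℝ) ≤ p S + ((∑ i ∈ S, φ i : ℝ) : WithTop ℝ)) ∧
      C = convexHull ℝ (indicatorVec '' {S | p S + ((∑ i ∈ S, φ i : ℝ) : WithTop ℝ) = d}) := by
  obtain ⟨F, ⟨-, φ, c, d, hc, hle, rfl⟩, rfl⟩ := hC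
  let f : ((Fin n → ℝ) × ℝ) →ₗ[ℝ] ℝ :=
    (∑ i, φ i • LinearMap.proj i) ∘ₗ LinearMap.fst ℝ _ _ + c • LinearMap.snd ℝ _ _
  have hf : ∀ z, f z = (∑ i, φ i * z.1 i) + c * z.2 := fun z => by simp [f]
  have hfS : ∀ (S : Finset (Fin n)) (r : ℝ),
      f (indicatorVec S, r) = c * (r + ∑ i ∈ S, φ i / c) := fun S r => by
    rw [hf, sum_mul_indicatorVec, ← Finset.sum_div]
    field_simp
    ring
  refine ⟨fun i => φ i / c, d / c, fun S => ?_, ?_⟩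
  · cases h : p S with
    | top => simp
    | coe r =>
      have := hle (indicatorVec S, r) (subset_convexHull ℝ _ ⟨S, r, h, rfl⟩)
      rw [← hf, hfS] at this
      norm_cast
      rwa [div_le_iff₀' hc]
  · simp only [← hf]
    rw [liftedPolytope, convexHull_inter_eq_of_forall_le _ f d
      (fun x hx => (hle x (subset_convexHull ℝ _ hx)).trans_eq (hf x).symm)]
    rw [show (Prod.fst : (Fin n → ℝ) × ℝ → _) = ⇑(LinearMap.fst ℝ (Fin n → ℝ) ℝ) from rfl,
      LinearMap.image_convexHull]
    congr 1
    ext v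
    constructor
    · rintro ⟨_, ⟨⟨S, r, hS, rfl⟩, h⟩, rfl⟩
      refine ⟨S, ?_, rfl⟩
      rw [hfS] at h
      simp only [Set.mem_ofPred_eq, hS]
      norm_cast
      rw [← h]
      field_simp
    · rintro ⟨S, hS, rfl⟩
      cases h : p S with
      | top => simp [h] at hS
      | coe r =>
        refine ⟨(indicatorVec S, r), ⟨⟨S, r, h, rfl⟩, ?_⟩, rfl⟩
        simp only [Set.mem_ofPred_eq, h] at hS
        norm_cast at hS
        rw [hfS, hS]
        field_simp

/-! ### Exchange for valuations of principal minors -/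

section PrincipalMinors

variable {K : Type*} [Field K] (ν : AddValuation K (WithTop ℝ))

theorem AddValuation.coe_sum_le_map_prod {ι : Type*} (s : Finset ι) (f : ι → K) (g : ι → ℝ)
    (h : ∀ i ∈ s, (g i : WithTop ℝ) ≤ ν (f i)) :
    ((∑ i ∈ s, g i : ℝ) : WithTop ℝ) ≤ ν (∏ i ∈ s, f i) := by
  classical
  induction s using Finset.induction_on with
  | empty => simp
  | insert a s ha ih =>
    rw [Finset.sum_insert ha, Finset.prod_insert ha, ν.map_mul, WithTop.coe_add]
    exact add_le_add (h a (by simp)) (ih fun i hi => h i (by simp [hi]))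

theorem AddValuation.coe_sum_lt_map_prod {ι : Type*} (s : Finset ι) (f : ι → K) (g : ι → ℝ)
    (h : ∀ i ∈ s, (g i : WithTop ℝ) ≤ ν (f i)) {a : ι} (ha : a ∈ s)
    (hlt : (g a : WithTop ℝ) < ν (f a)) :
    ((∑ i ∈ s, g i : ℝ) : WithTop ℝ) < ν (∏ i ∈ s, f i) := by
  classical
  rw [← Finset.add_sum_erase _ _ ha, ← Finset.mul_prod_erase _ _ ha, ν.map_mul, WithTop.coe_add]
  exact WithTop.add_lt_add_of_lt_of_le WithTop.coe_ne_top hlt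
    (ν.coe_sum_le_map_prod _ f g fun i hi => h i (Finset.mem_of_mem_erase hi))

theorem AddValuation.map_units_smul (u : ℤˣ) (x : K) : ν (u • x) = ν x := by
  rcases Int.units_eq_one_or u with rfl | rfl
  · simp
  · simp [Units.smul_def, ν.map_neg]

theorem WithTop.coe_half_le {r : ℝ} {x : WithTop ℝ} (h : (r : WithTop ℝ) ≤ 2 • x) :
    ((r / 2 : ℝ) : WithTop ℝ) ≤ x := by
  cases x with
  | top => simp
  | coe x =>
    rw [two_nsmul] at h
    norm_cast at h ⊢
    linarith

theorem WithTop.coe_half_lt {r : ℝ} {x : WithTop ℝ} (h : (r : WithTop ℝ) < 2 • x) :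
    ((r / 2 : ℝ) : WithTop ℝ) < x := by
  cases x with
  | top => simp
  | coe x =>
    rw [two_nsmul] at h
    norm_cast at h ⊢
    linarith

variable {ι : Type*}

/-- The principal minor of `N` on the rows and columns in `T`. -/
def Matrix.principalMinor [DecidableEq ι] (N : Matrix ι ι K) (T : Finset ι) : K :=
  (N.submatrix (Subtype.val : {i // i ∈ T} → ι) Subtype.val).det

theorem Matrix.principalMinor_singleton [DecidableEq ι] (N : Matrix ι ι K) (a : ι) :
    N.principalMinor {a} = N a a := by
  have : Subsingleton {i // i ∈ ({a} : Finset ι)} := ⟨fun x y => Subtype.ext <| by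
    rw [Finset.mem_singleton.1 x.2, Finset.mem_singleton.1 y.2]⟩
  exact Matrix.det_eq_elem_of_subsingleton (N.submatrix Subtype.val Subtype.val)
    (⟨a, Finset.mem_singleton_self a⟩ : {i // i ∈ ({a} : Finset ι)})

theorem Matrix.principalMinor_pair [DecidableEq ι] (N : Matrix ι ι K) {a b : ι} (hab : a ≠ b) :
    N.principalMinor {a, b} = N a a * N b b - N a b * N b a := by
  let g : Fin 2 → {i // i ∈ ({a, b} : Finset ι)} := ![⟨a, by simp⟩, ⟨b, by simp⟩]
  have hg : Function.Bijective g := by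
    constructor
    · intro i j
      fin_cases i <;> fin_cases j <;> simp [g, hab, hab.symm]
    · rintro ⟨i, hi⟩
      rcases Finset.mem_insert.1 hi with rfl | hi
      · exact ⟨0, rfl⟩
      · obtain rfl := Finset.mem_singleton.1 hi
        exact ⟨1, rfl⟩
  rw [Matrix.principalMinor, ← Matrix.det_submatrix_equiv_self (Equiv.ofBijective g hg),
    Matrix.det_fin_two]
  rfl

/-- The ultrametric condition on a square matrix from which the exchange property of its principal
minors follows: each off-diagonal entry is controlled by the principal minors of size `1` and `2`
on its two indices. -/
def OffDiagControlled (N : Matrix ι ι K) : Prop :=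
  ∀ i j, i ≠ j → min (ν (N i i) + ν (N j j)) (ν (N i i * N j j - N i j * N j i)) ≤ 2 • ν (N i j)

variable {ν}

theorem OffDiagControlled.of_valuation_symm {N : Matrix ι ι K}
    (h : ∀ i j, ν (N j i) = ν (N i j)) : OffDiagControlled ν N := by
  intro i j _
  have := ν.map_sub (N i i * N j j) (N i i * N j j - N i j * N j i)
  rwa [sub_sub_cancel, ν.map_mul, ν.map_mul, h i j, ← two_nsmul] at this

/-- A matrix that is alternating up to `-c • g gᵀ` is controlled, because its principal
`2 × 2` minors are squares. -/
theorem OffDiagControlled.of_alternating_sub {N : Matrix ι ι K} (c : K) (g : ι → K)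
    (hdiag : ∀ i, N i i = -(c * g i ^ 2)) (hoff : ∀ i j, N i j + N j i = -(2 * c * g i * g j)) :
    OffDiagControlled ν N := by
  intro i j _
  have hdet : N i i * N j j - N i j * N j i = (N i j + c * g i * g j) ^ 2 := by
    rw [hdiag i, hdiag j, eq_sub_of_add_eq' (hoff i j)]
    ring
  have hprod : N i i * N j j = (c * g i * g j) ^ 2 := by
    rw [hdiag i, hdiag j]
    ring
  rw [hdet, ← ν.map_mul, hprod, ν.map_pow, ν.map_pow]
  have h := ν.map_sub (N i j + c * g i * g j) (c * g i * g j)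
  rw [add_sub_cancel_right, min_comm] at h
  rw [← (nsmul_right_mono 2).map_min]
  exact nsmul_le_nsmul_right h 2

/-- If no principal minor of `N` has valuation below the weight of its index set, and equality
holds for `B`, then equality holds for some `{a, b}`, `b ∈ B`. The bounds on minors of size `1` and
`2` force each term of the Leibniz expansion of the `B`-minor to have valuation at least the weight
of `B`; if no `b` existed, row `a` would make all of them strictly larger. -/
theorem OffDiagControlled.exists_pair [DecidableEq ι] {N : Matrix ι ι K}
    (hN : OffDiagControlled ν N) (w : ι → ℝ)
    (hw : ∀ T : Finset ι, ((∑ i ∈ T, w i : ℝ) : WithTop ℝ) ≤ ν (N.principalMinor T))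
    {B : Finset ι} (hB : ν (N.principalMinor B) = ((∑ i ∈ B, w i : ℝ) : WithTop ℝ))
    {a : ι} (ha : a ∈ B) :
    ∃ b ∈ B, ν (N.principalMinor {a, b}) = ((∑ i ∈ {a, b}, w i : ℝ) : WithTop ℝ) := by
  by_contra! hne
  have hdiag : ∀ i, (w i : WithTop ℝ) ≤ ν (N i i) := fun i => by
    simpa [N.principalMinor_singleton] using hw {i}
  have hentry : ∀ i j, (((w i + w j) / 2 : ℝ) : WithTop ℝ) ≤ ν (N i j) := by
    intro i j
    obtain rfl | hij := eq_or_ne i j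
    · simpa using hdiag i
    · refine WithTop.coe_half_le (le_trans (le_min ?_ ?_) (hN i j hij))
      · rw [WithTop.coe_add]
        exact add_le_add (hdiag i) (hdiag j)
      · simpa [N.principalMinor_pair hij, Finset.sum_pair hij] using hw {i, j}
  have haa : (w a : WithTop ℝ) < ν (N a a) := by
    refine lt_of_le_of_ne (hdiag a) fun h => hne a ha ?_
    simpa [N.principalMinor_singleton] using h.symm
  have hrow : ∀ b ∈ B, (((w a + w b) / 2 : ℝ) : WithTop ℝ) < ν (N a b) := by
    intro b hb
    obtain rfl | hab := eq_or_ne a b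
    · simpa using haa
    · refine WithTop.coe_half_lt (lt_of_lt_of_le (lt_min ?_ ?_) (hN a b hab))
      · rw [WithTop.coe_add]
        exact WithTop.add_lt_add_of_lt_of_le WithTop.coe_ne_top haa (hdiag b)
      · have h := lt_of_le_of_ne (hw {a, b}) (hne b hb).symm
        rwa [N.principalMinor_pair hab, Finset.sum_pair hab] at h
  refine absurd hB (ne_of_gt ?_)
  rw [Matrix.principalMinor, Matrix.det_apply]
  refine ν.map_lt_sum WithTop.coe_ne_top fun σ _ => ?_
  rw [ν.map_units_smul]
  have hsum : ∑ i ∈ B, w i = ∑ i : {i // i ∈ B}, (w (σ i) + w i) / 2 := by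
    rw [← Finset.sum_div, Finset.sum_add_distrib,
      Equiv.sum_comp σ (fun i : {i // i ∈ B} => w i), ← Finset.sum_coe_sort B]
    ring
  rw [hsum]
  refine ν.coe_sum_lt_map_prod Finset.univ _ _ (fun i _ => hentry _ _)
    (Finset.mem_univ (σ.symm ⟨a, ha⟩)) ?_
  simpa using hrow _ (σ.symm ⟨a, ha⟩).2

end PrincipalMinors

/-! ### Minors of a matrix in Witt coordinates -/

section Minors

variable {K : Type*} [Field K] {n m : ℕ}

/-- The column chosen by `S` in position `i`: that of `e_i` if `i ∈ S`, that of `f_i` otherwise. -/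
def wittCol (S : Finset (Fin n)) (i : Fin n) : WittIdx n m :=
  if i ∈ S then eIdx i else fIdx i

/-- The square matrix of the columns that `A` leaves out, after row operations that turn the
columns chosen by `A` into the identity matrix (when these are independent). -/
noncomputable def reducedMinorMatrix (M : Matrix (Fin n) (WittIdx n m) K) (A : Finset (Fin n)) :
    Matrix (Fin n) (Fin n) K :=
  ((M.submatrix id (wittCol A))⁻¹ * M).submatrix id (wittCol Aᶜ)

theorem wittCol_symmDiff (A T : Finset (Fin n)) (i : Fin n) :
    (wittCol (symmDiff A T) i : WittIdx n m) = if i ∈ T then wittCol Aᶜ i else wittCol A i := by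
  by_cases hA : i ∈ A <;> by_cases hT : i ∈ T <;> simp [wittCol, Finset.mem_symmDiff, hA, hT]

/-- A matrix whose columns outside `T` are those of the identity has determinant its principal
minor on `T`. -/
theorem Matrix.det_eq_principalMinor {C N : Matrix (Fin n) (Fin n) K} {T : Finset (Fin n)}
    (hN : ∀ i, ∀ j ∈ T, C i j = N i j) (h1 : ∀ i, ∀ j ∉ T, C i j = (1 : Matrix _ _ K) i j) :
    C.det = N.principalMinor T := by
  have hzero : ∀ i, i ∈ T → ∀ j, j ∉ T → C i j = 0 := fun i hi j hj => by
    rw [h1 i j hj, Matrix.one_apply_ne (ne_of_mem_of_not_mem hi hj)]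
  have hone : C.toSquareBlockProp (fun i => i ∉ T) = 1 := by
    ext i j
    simp [Matrix.toSquareBlockProp, h1 _ _ j.2, Matrix.one_apply, Subtype.ext_iff]
  have hT : C.toSquareBlockProp (fun i => i ∈ T) =
      N.submatrix (Subtype.val : {i // i ∈ T} → Fin n) Subtype.val := by
    ext i j
    exact hN i j j.2
  rw [Matrix.twoBlockTriangular_det' C (fun i => i ∈ T) hzero, hone, Matrix.det_one, mul_one, hT,
    Matrix.principalMinor]
  congr!

theorem inv_mul_submatrix_wittCol {M : Matrix (Fin n) (WittIdx n m) K} {A : Finset (Fin n)}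
    (hA : (M.submatrix id (wittCol A)).det ≠ 0) :
    ((M.submatrix id (wittCol A))⁻¹ * M).submatrix id (wittCol A) = 1 := by
  rw [Matrix.submatrix_mul _ M id id (wittCol A) Function.bijective_id, Matrix.submatrix_id_id,
    Matrix.nonsing_inv_mul _ (isUnit_iff_ne_zero.2 hA)]

/-- Passing from the columns chosen by `A` to those chosen by `A Δ T` multiplies the minor by the
principal minor on `T` of the reduced matrix. -/
theorem minorValuation_symmDiff (ν : AddValuation K (WithTop ℝ))
    (M : Matrix (Fin n) (WittIdx n m) K) {A : Finset (Fin n)}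
    (hA : (M.submatrix id (wittCol A)).det ≠ 0) (T : Finset (Fin n)) :
    minorValuation ν M (symmDiff A T) =
      minorValuation ν M A + ν ((reducedMinorMatrix M A).principalMinor T) := by
  have hu : IsUnit (M.submatrix id (wittCol A)).det := isUnit_iff_ne_zero.2 hA
  set P := M.submatrix id (wittCol A)
  have hmul : P * (P⁻¹ * M) = M := Matrix.mul_nonsing_inv_cancel_left P M hu
  have hone : (P⁻¹ * M).submatrix id (wittCol A) = 1 := inv_mul_submatrix_wittCol hA
  have hfac : M.submatrix id (wittCol (symmDiff A T)) =
      P * (P⁻¹ * M).submatrix id (wittCol (symmDiff A T)) := by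
    conv_lhs => rw [← hmul]
    rw [Matrix.submatrix_mul P _ id id _ Function.bijective_id, Matrix.submatrix_id_id]
  change ν (M.submatrix id (wittCol (symmDiff A T))).det = ν P.det + _
  have hdet : ((P⁻¹ * M).submatrix id (wittCol (symmDiff A T))).det =
      (reducedMinorMatrix M A).principalMinor T := by
    refine Matrix.det_eq_principalMinor (fun i j hj => ?_) fun i j hj => ?_
    · rw [Matrix.submatrix_apply, wittCol_symmDiff, if_pos hj]
      rfl
    · rw [Matrix.submatrix_apply, wittCol_symmDiff, if_neg hj, ← hone]
      rfl
  rw [hfac, Matrix.det_mul, ν.map_mul, hdet]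

theorem sum_symmDiff_eq_add_sum (φ : Fin n → ℝ) (A T : Finset (Fin n)) :
    ∑ i ∈ symmDiff A T, φ i = ∑ i ∈ A, φ i + ∑ i ∈ T, (if i ∈ A then -φ i else φ i) := by
  rw [← Finset.univ_inter (symmDiff A T), ← Finset.univ_inter A, ← Finset.univ_inter T,
    ← Finset.sum_ite_mem, ← Finset.sum_ite_mem, ← Finset.sum_ite_mem, ← Finset.sum_add_distrib]
  refine Finset.sum_congr rfl fun i _ => ?_
  by_cases hA : i ∈ A <;> by_cases hT : i ∈ T <;> simp [Finset.mem_symmDiff, hA, hT]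

/-- The valuated Delta-matroid property, reduced to the ultrametric condition on the matrices
obtained by row reduction at each nonvanishing minor. -/
theorem isValuatedDeltaMatroid_minorValuation (ν : AddValuation K (WithTop ℝ))
    (M : Matrix (Fin n) (WittIdx n m) K)
    (h : ∀ A, (M.submatrix id (wittCol A)).det ≠ 0 →
      OffDiagControlled ν (reducedMinorMatrix M A)) :
    IsValuatedDeltaMatroid (minorValuation ν M) := by
  intro C hC
  obtain ⟨φ, d, hle, rfl⟩ := exists_weight_of_mem_inducedSubdivision hC
  refine ⟨_, ?_, rfl⟩
  intro A hA B hB a ha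
  simp only [Set.mem_ofPred_eq] at hA hB ⊢
  obtain ⟨r, hr⟩ : ∃ r : ℝ, minorValuation ν M A = r := by
    cases hr : minorValuation ν M A with
    | top => simp [hr] at hA
    | coe r => exact ⟨r, rfl⟩
  have hdet : (M.submatrix id (wittCol A)).det ≠ 0 := by
    intro h0
    have : minorValuation ν M A = ν (M.submatrix id (wittCol A)).det := rfl
    rw [this, h0, ν.map_zero] at hr
    exact WithTop.top_ne_coe hr
  rw [hr] at hA
  norm_cast at hA
  -- Toggling the elements of `T` changes `φ(A)` by `w(T)`, so `A Δ T` is a minimizer exactly when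
  -- the valuation of the principal minor on `T` attains its lower bound `-w(T)`.
  set w : Fin n → ℝ := fun i => if i ∈ A then -φ i else φ i with hw
  have key : ∀ T : Finset (Fin n), minorValuation ν M (symmDiff A T) +
      ((∑ i ∈ symmDiff A T, φ i : ℝ) : WithTop ℝ) =
      ν ((reducedMinorMatrix M A).principalMinor T) + ((d + ∑ i ∈ T, w i : ℝ) : WithTop ℝ) := by
    intro T
    rw [minorValuation_symmDiff ν M hdet, sum_symmDiff_eq_add_sum, hr, ← hA]
    cases ν ((reducedMinorMatrix M A).principalMinor T) with
    | top => simp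
    | coe x =>
      norm_cast
      ring
  have hiff : ∀ T : Finset (Fin n), minorValuation ν M (symmDiff A T) +
      ((∑ i ∈ symmDiff A T, φ i : ℝ) : WithTop ℝ) = d ↔
      ν ((reducedMinorMatrix M A).principalMinor T) = ((∑ i ∈ T, -w i : ℝ) : WithTop ℝ) := by
    intro T
    rw [key, Finset.sum_neg_distrib]
    cases ν ((reducedMinorMatrix M A).principalMinor T) with
    | top => exact iff_of_false (by simp) WithTop.top_ne_coe
    | coe x =>
      norm_cast
      constructor <;> intro <;> linarith
  obtain ⟨b, hb, hab⟩ := (h A hdet).exists_pair (fun i => -w i) (fun T => by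
      have := hle (symmDiff A T)
      rw [key] at this
      rw [Finset.sum_neg_distrib]
      cases hx : ν ((reducedMinorMatrix M A).principalMinor T) with
      | top => simp
      | coe x =>
        rw [hx] at this
        norm_cast at this ⊢
        linarith) (B := symmDiff A B) ((hiff _).1 (by rwa [symmDiff_symmDiff_cancel_left])) ha
  exact ⟨b, hb, (hiff _).2 hab⟩

end Minors

/-! ### Maximal isotropic subspaces -/

section Isotropic

variable {K : Type*} [Field K] {V : Type*} [AddCommGroup V] [Module K V]

/-- If `U` is totally isotropic and `dim L < dim U`, then some vector of `U` outside `L` is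
orthogonal to `L`: since `L ∩ U` is orthogonal to `U`, only `dim L - dim (L ∩ U)` linear conditions
cut out the vectors of `U` that are orthogonal to `L`. -/
theorem exists_notMem_forall_eq_zero_of_finrank_lt [FiniteDimensional K V]
    {σ : K →+* K} (b : V →ₗ[K] V →ₛₗ[σ] K)
    {U L : Submodule K V} (hU : IsIsotropicForm (fun x y => b x y) U)
    (hlt : Module.finrank K L < Module.finrank K U) :
    ∃ u ∈ U, u ∉ L ∧ ∀ l ∈ L, b u l = 0 := by
  obtain ⟨D, hD⟩ := Submodule.exists_isCompl (U.comap L.subtype)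
  let β := Module.finBasis K D
  let g : U →ₗ[K] (Fin (Module.finrank K D) → K) :=
    { toFun := fun u i => b u (β i : L)
      map_add' := fun u v => by ext; simp
      map_smul' := fun c u => by ext; simp }
  have hker : ∀ u ∈ LinearMap.ker g, ∀ l ∈ L, b u l = 0 := by
    intro u hu l hl
    have hDle : D ≤ LinearMap.ker ((b u).comp L.subtype) := by
      have hspan := β.span_eq
      have : D = Submodule.span K (Set.range fun i => (β i : L)) := by
        rw [Set.range_comp' Subtype.val β, ← Submodule.coe_subtype, Submodule.span_image, hspan,
          Submodule.map_top, Submodule.range_subtype]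
      rw [this, Submodule.span_le]
      rintro _ ⟨i, rfl⟩
      exact congrFun (LinearMap.mem_ker.1 hu) i
    have hCle : U.comap L.subtype ≤ LinearMap.ker ((b u).comp L.subtype) :=
      fun x hx => hU u u.2 x hx
    have : (⟨l, hl⟩ : L) ∈ LinearMap.ker ((b u).comp L.subtype) :=
      sup_le hCle hDle (hD.sup_eq_top ▸ Submodule.mem_top)
    exact this
  by_contra! hcon
  have hle : LinearMap.ker g ≤ L.comap U.subtype := by
    intro u hu
    by_contra hn
    obtain ⟨l, hl, hne⟩ := hcon u u.2 hn
    exact hne (hker u hu l hl)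
  have h1 := Submodule.finrank_mono hle
  have h2 := LinearMap.finrank_range_add_finrank_ker g
  have h3 : Module.finrank K (LinearMap.range g) ≤ Module.finrank K D := by
    simpa using (LinearMap.range g).finrank_le
  have h4 := Submodule.finrank_add_eq_of_isCompl hD
  have h5 : Module.finrank K (U.comap L.subtype) = Module.finrank K (L.comap U.subtype) := by
    rw [← Submodule.finrank_map_subtype_eq L, ← Submodule.finrank_map_subtype_eq U,
      Submodule.map_comap_subtype,
      Submodule.map_comap_subtype, inf_comm]
  omega

theorem exists_finrank_eq_wittIndex [FiniteDimensional K V]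
    {Iso : Submodule K V → Prop} (hbot : Iso ⊥) :
    ∃ U, Iso U ∧ Module.finrank K U = wittIndex Iso :=
  Nat.sSup_mem (s := {d | ∃ W : Submodule K V, Iso W ∧ Module.finrank K W = d})
    ⟨0, ⊥, hbot, finrank_bot K V⟩
    ⟨Module.finrank K V, by rintro _ ⟨W, -, rfl⟩; exact W.finrank_le⟩

theorem finrank_le_wittIndex [FiniteDimensional K V]
    {Iso : Submodule K V → Prop} {L : Submodule K V} (hL : Iso L) :
    Module.finrank K L ≤ wittIndex Iso :=
  le_csSup ⟨Module.finrank K V, by rintro _ ⟨W, -, rfl⟩; exact W.finrank_le⟩ ⟨L, hL, rfl⟩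

/-- Maximal isotropic subspaces of a reflexive sesquilinear form have the dimension given by the
Witt index. -/
theorem finrank_eq_wittIndex_of_maximal [FiniteDimensional K V]
    {σ : K →+* K} (b : V →ₗ[K] V →ₛₗ[σ] K)
    (hrefl : ∀ x y, b x y = 0 → b y x = 0) {L : Submodule K V}
    (hL : Maximal (IsIsotropicForm fun x y => b x y) L) :
    Module.finrank K L = wittIndex (IsIsotropicForm (K := K) fun x y => b x y) := by
  refine le_antisymm (finrank_le_wittIndex hL.prop) (not_lt.1 fun hlt => ?_)
  obtain ⟨U, hU, hUd⟩ := exists_finrank_eq_wittIndex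
    (Iso := IsIsotropicForm (K := K) fun x y => b x y) (fun x hx y _ => by
      rw [(Submodule.mem_bot K).1 hx]; simp)
  obtain ⟨u, huU, huL, hu⟩ := exists_notMem_forall_eq_zero_of_finrank_lt b hU (hlt.trans_eq hUd.symm)
  refine huL (hL.le_of_ge (y := L ⊔ Submodule.span K {u}) ?_ le_sup_left
    (Submodule.mem_sup_right (Submodule.mem_span_singleton_self u)))
  intro x hx y hy
  obtain ⟨l, hl, _, hx', rfl⟩ := Submodule.mem_sup.1 hx
  obtain ⟨α, rfl⟩ := Submodule.mem_span_singleton.1 hx'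
  obtain ⟨l', hl', _, hy', rfl⟩ := Submodule.mem_sup.1 hy
  obtain ⟨β, rfl⟩ := Submodule.mem_span_singleton.1 hy'
  simp [hL.prop l hl l' hl', hu l' hl', hrefl _ _ (hu l hl), hU u huU u huU]

theorem IsIsotropicQuadratic.isIsotropicForm_polarBilin {q : QuadraticForm K V}
    {L : Submodule K V} (hL : IsIsotropicQuadratic q L) :
    IsIsotropicForm (fun x y => QuadraticMap.polarBilin q x y) L := by
  intro x hx y hy
  simp [QuadraticMap.polar, hL _ (L.add_mem hx hy), hL x hx, hL y hy]

/-- Maximal totally singular subspaces of a quadratic form have the dimension given by the Witt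
index. -/
theorem finrank_eq_wittIndex_of_maximal_quadratic [FiniteDimensional K V]
    (q : QuadraticForm K V) {L : Submodule K V}
    (hL : Maximal (IsIsotropicQuadratic q) L) :
    Module.finrank K L = wittIndex (IsIsotropicQuadratic (K := K) q) := by
  refine le_antisymm (finrank_le_wittIndex hL.prop) (not_lt.1 fun hlt => ?_)
  obtain ⟨U, hU, hUd⟩ := exists_finrank_eq_wittIndex
    (Iso := IsIsotropicQuadratic (K := K) q) (fun x hx => by
      rw [(Submodule.mem_bot K).1 hx]; simp)
  obtain ⟨u, huU, huL, hu⟩ := exists_notMem_forall_eq_zero_of_finrank_lt q.polarBilin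
    hU.isIsotropicForm_polarBilin (hlt.trans_eq hUd.symm)
  refine huL (hL.le_of_ge (y := L ⊔ Submodule.span K {u}) ?_ le_sup_left
    (Submodule.mem_sup_right (Submodule.mem_span_singleton_self u)))
  intro x hx
  obtain ⟨l, hl, _, hx', rfl⟩ := Submodule.mem_sup.1 hx
  obtain ⟨α, rfl⟩ := Submodule.mem_span_singleton.1 hx'
  have hul : QuadraticMap.polar q l u = 0 := by
    rw [QuadraticMap.polar_comm]
    exact hu l hl
  rw [QuadraticMap.map_add q, QuadraticMap.map_smul, QuadraticMap.polar_smul_right, hul,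
    hL.prop l hl, hU u huU]
  simp

theorem exists_represents [FiniteDimensional K V] {n m : ℕ}
    (B : Module.Basis (WittIdx n m) K V) {L : Submodule K V}
    (hL : Module.finrank K L = n) : ∃ M, Represents B M L := by
  let β := Module.finBasisOfFinrankEq K L hL
  have hrow : (fun r : Fin n => ∑ j, B.repr (β r : V) j • B j) = fun r => (β r : V) :=
    funext fun r => B.sum_repr _
  refine ⟨fun r j => B.repr (β r : V) j, ?_, ?_⟩
  · rw [hrow]
    exact β.linearIndependent.map' L.subtype (Submodule.ker_subtype L)
  · rw [hrow, Set.range_comp' Subtype.val β, ← Submodule.coe_subtype, Submodule.span_image,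
      β.span_eq, Submodule.map_top, Submodule.range_subtype]

end Isotropic

/-! ### Isotropy in Witt coordinates -/

section WittCoordinates

variable {K : Type*} [Field K] {V : Type*} [AddCommGroup V] [Module K V] {n m : ℕ}
  {B : Module.Basis (WittIdx n m) K V}

theorem wittCol_mem_hypPlane (A : Finset (Fin n)) (i : Fin n) :
    B (wittCol A i) ∈ hypPlane B i := by
  refine Submodule.subset_span ?_
  by_cases h : i ∈ A <;> simp [wittCol, h]

/-- Row reduction at a nonvanishing minor: `L` contains, for each `i`, a vector that is the sum of
the basis vector chosen by `A` in the plane `H_i`, a combination of the basis vectors not chosen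
by `A`, and a vector of the anisotropic part. -/
theorem Represents.exists_reduced_row_mem {M : Matrix (Fin n) (WittIdx n m) K}
    {L : Submodule K V} (hM : Represents B M L) {A : Finset (Fin n)}
    (hA : (M.submatrix id (wittCol A)).det ≠ 0) (i : Fin n) :
    ∃ w ∈ anisoPart B,
      B (wittCol A i) + ∑ j, reducedMinorMatrix M A i j • B (wittCol Aᶜ j) + w ∈ L := by
  set P := M.submatrix id (wittCol A)
  have hone : (P⁻¹ * M).submatrix id (wittCol A) = 1 := inv_mul_submatrix_wittCol hA
  have hmem : ∑ c, (P⁻¹ * M) i c • B c ∈ L := by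
    have : ∑ c, (P⁻¹ * M) i c • B c = ∑ r, P⁻¹ i r • ∑ c, M r c • B c := by
      simp only [Matrix.mul_apply, Finset.sum_smul, Finset.smul_sum, mul_smul]
      exact Finset.sum_comm
    rw [this, ← hM.2]
    exact Submodule.sum_mem _ fun r _ =>
      Submodule.smul_mem _ _ (Submodule.subset_span ⟨r, rfl⟩)
  refine ⟨∑ k, (P⁻¹ * M) i (Sum.inr k) • B (Sum.inr k), Submodule.sum_mem _ fun k _ =>
    Submodule.smul_mem _ _ (Submodule.subset_span ⟨k, rfl⟩), ?_⟩
  convert hmem using 1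
  rw [Fintype.sum_sum_type, Fintype.sum_sum_type, ← Finset.sum_add_distrib]
  congr 1
  have hx : B (wittCol A i) = ∑ j, (P⁻¹ * M) i (wittCol A j) • B (wittCol A j) := by
    have h : ∀ j, (P⁻¹ * M) i (wittCol A j) = (1 : Matrix (Fin n) (Fin n) K) i j := fun j => by
      rw [← hone]
      rfl
    simp [h, Matrix.one_apply]
  rw [hx, ← Finset.sum_add_distrib]
  refine Finset.sum_congr rfl fun j _ => ?_
  change _ + (P⁻¹ * M) i (wittCol Aᶜ j) • _ = _
  by_cases hj : j ∈ A
  · simp [wittCol, hj, eIdx, fIdx]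
  · simp [wittCol, hj, eIdx, fIdx, add_comm]

section Sesquilinear

variable {σ : K →+* K} {b : V →ₗ[K] V →ₛₗ[σ] K} {Q : V → K}

theorem IsWittBasis.apply_wittCol_wittCol (hB : IsWittBasis (fun x y => b x y) Q B)
    (he : ∀ i, b (B (eIdx i)) (B (eIdx i)) = 0) (hf : ∀ i, b (B (fIdx i)) (B (fIdx i)) = 0)
    (A : Finset (Fin n)) (i j : Fin n) : b (B (wittCol A i)) (B (wittCol A j)) = 0 := by
  obtain rfl | hij := eq_or_ne i j
  · by_cases h : i ∈ A <;> simp [wittCol, h, he, hf]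
  · exact hB.planes_orthogonal i j hij _ (wittCol_mem_hypPlane A i) _ (wittCol_mem_hypPlane A j)

theorem IsWittBasis.apply_wittCol_sum (hB : IsWittBasis (fun x y => b x y) Q B)
    (A A' : Finset (Fin n)) (c : Fin n → K) (i : Fin n) :
    b (B (wittCol A i)) (∑ j, c j • B (wittCol A' j)) =
      σ (c i) * b (B (wittCol A i)) (B (wittCol A' i)) := by
  rw [map_sum, Fintype.sum_eq_single i, LinearMap.map_smulₛₗ, smul_eq_mul]
  intro j hj
  rw [LinearMap.map_smulₛₗ, hB.planes_orthogonal i j hj.symm _ (wittCol_mem_hypPlane A i) _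
    (wittCol_mem_hypPlane A' j), smul_zero]

theorem IsWittBasis.apply_sum_wittCol (hB : IsWittBasis (fun x y => b x y) Q B)
    (A A' : Finset (Fin n)) (c : Fin n → K) (i : Fin n) :
    b (∑ j, c j • B (wittCol A' j)) (B (wittCol A i)) =
      c i * b (B (wittCol A' i)) (B (wittCol A i)) := by
  rw [map_sum, LinearMap.sum_apply, Fintype.sum_eq_single i, map_smul, LinearMap.smul_apply,
    smul_eq_mul]
  intro j hj
  rw [map_smul, LinearMap.smul_apply, hB.planes_orthogonal j i hj _ (wittCol_mem_hypPlane A' j) _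
    (wittCol_mem_hypPlane A i), smul_zero]

theorem IsWittBasis.apply_sum_sum (hB : IsWittBasis (fun x y => b x y) Q B)
    (he : ∀ i, b (B (eIdx i)) (B (eIdx i)) = 0) (hf : ∀ i, b (B (fIdx i)) (B (fIdx i)) = 0)
    (A : Finset (Fin n)) (c d : Fin n → K) :
    b (∑ j, c j • B (wittCol A j)) (∑ j, d j • B (wittCol A j)) = 0 := by
  rw [map_sum b, LinearMap.sum_apply]
  refine Finset.sum_eq_zero fun i _ => ?_
  rw [map_smul, LinearMap.smul_apply, hB.apply_wittCol_sum,
    hB.apply_wittCol_wittCol he hf, mul_zero, smul_zero]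

theorem IsWittBasis.apply_add_anisoPart (hB : IsWittBasis (fun x y => b x y) Q B)
    (A : Finset (Fin n)) (c : Fin n → K) (i : Fin n) {w : V} (hw : w ∈ anisoPart B) :
    b (B (wittCol A i) + ∑ j, c j • B (wittCol Aᶜ j)) w = 0 ∧
      b w (B (wittCol A i) + ∑ j, c j • B (wittCol Aᶜ j)) = 0 := by
  have h : ∀ (A' : Finset (Fin n)) j, b (B (wittCol A' j)) w = 0 ∧ b w (B (wittCol A' j)) = 0 :=
    fun A' j => hB.rest_orthogonal j _ (wittCol_mem_hypPlane A' j) w hw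
  constructor
  · simp [h]
  · simp only [map_add, map_sum, LinearMap.map_smulₛₗ, h, smul_zero, Finset.sum_const_zero,
      add_zero]

/-- The value of a sesquilinear form on two row-reduced vectors. -/
theorem IsWittBasis.apply_reduced_row (hB : IsWittBasis (fun x y => b x y) Q B)
    (he : ∀ i, b (B (eIdx i)) (B (eIdx i)) = 0) (hf : ∀ i, b (B (fIdx i)) (B (fIdx i)) = 0)
    (A : Finset (Fin n)) (N : Matrix (Fin n) (Fin n) K) (i k : Fin n) {w w' : V}
    (hw : w ∈ anisoPart B) (hw' : w' ∈ anisoPart B) :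
    b (B (wittCol A i) + ∑ j, N i j • B (wittCol Aᶜ j) + w)
      (B (wittCol A k) + ∑ j, N k j • B (wittCol Aᶜ j) + w') =
      σ (N k i) * b (B (wittCol A i)) (B (wittCol Aᶜ i)) +
        N i k * b (B (wittCol Aᶜ k)) (B (wittCol A k)) + b w w' := by
  rw [map_add b, LinearMap.add_apply, map_add (b _), map_add (b w),
    (hB.apply_add_anisoPart A (N i) i hw').1, (hB.apply_add_anisoPart A (N k) k hw).2,
    map_add b, LinearMap.add_apply, map_add (b _), map_add (b _),
    hB.apply_wittCol_wittCol he hf, hB.apply_wittCol_sum, hB.apply_sum_wittCol,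
    hB.apply_sum_sum he hf]
  ring

end Sesquilinear

theorem eq_zero_of_mem_anisoPart (hm : m = 0) {w : V} (hw : w ∈ anisoPart B) : w = 0 := by
  subst hm
  simpa [anisoPart] using hw

theorem exists_generator_anisoPart (hm : m ≤ 1) :
    ∃ g : V, ∀ w ∈ anisoPart B, ∃ γ : K, w = γ • g := by
  obtain rfl | rfl : m = 0 ∨ m = 1 := by omega
  · exact ⟨0, fun w hw => ⟨0, by simpa using eq_zero_of_mem_anisoPart rfl hw⟩⟩
  · refine ⟨B (Sum.inr 0), fun w hw => ?_⟩
    rw [anisoPart, Set.range_unique] at hw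
    obtain ⟨γ, rfl⟩ := Submodule.mem_span_singleton.1 hw
    exact ⟨γ, rfl⟩

/-- If there is no anisotropic part, `σ` preserves the valuation and the values `b f_i e_i` have
valuation zero, then isotropy expresses each entry of a reduced matrix as a factor of valuation zero
times the `σ`-conjugate of the transposed entry, so transposed entries have equal valuations. -/
theorem isValuatedDeltaMatroid_of_sesquilinear (ν : AddValuation K (WithTop ℝ)) (hm : m = 0)
    {σ : K →+* K} (hσ : ∀ a, ν (σ a) = ν a) {b : V →ₗ[K] V →ₛₗ[σ] K} {Q : V → K}
    (hB : IsWittBasis (fun x y => b x y) Q B)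
    (he : ∀ i, b (B (eIdx i)) (B (eIdx i)) = 0) (hf : ∀ i, b (B (fIdx i)) (B (fIdx i)) = 0)
    (hfe : ∀ i, ν (b (B (fIdx i)) (B (eIdx i))) = 0)
    {L : Submodule K V} (hL : IsIsotropicForm (fun x y => b x y) L)
    {M : Matrix (Fin n) (WittIdx n m) K} (hM : Represents B M L) :
    IsValuatedDeltaMatroid (minorValuation ν M) := by
  refine isValuatedDeltaMatroid_minorValuation ν M fun A hA =>
    OffDiagControlled.of_valuation_symm fun i k => ?_
  obtain ⟨w, hw, hi⟩ := hM.exists_reduced_row_mem hA i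
  obtain ⟨w', hw', hk⟩ := hM.exists_reduced_row_mem hA k
  have h : b _ _ = 0 := hL _ hi _ hk
  rw [hB.apply_reduced_row he hf A _ i k hw hw', eq_zero_of_mem_anisoPart hm hw, map_zero,
    LinearMap.zero_apply, add_zero] at h
  have hpair : ∀ i, ν (b (B (eIdx i)) (B (fIdx i))) = 0 := fun i => by
    rw [show b (B (eIdx i)) (B (fIdx i)) = 1 from hB.pairing i, ν.map_one]
  have h1 : ν (b (B (wittCol A i)) (B (wittCol Aᶜ i))) = 0 := by
    by_cases hiA : i ∈ A <;> simp [wittCol, hiA, hfe, hpair]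
  have h2 : ν (b (B (wittCol Aᶜ k)) (B (wittCol A k))) = 0 := by
    by_cases hkA : k ∈ A <;> simp [wittCol, hkA, hfe, hpair]
  have h3 := congrArg ν (eq_neg_of_add_eq_zero_left h)
  rwa [ν.map_neg, ν.map_mul, ν.map_mul, h1, h2, add_zero, add_zero, hσ] at h3

theorem QuadraticMap.map_sum_smul_eq_zero (q : QuadraticForm K V) {ι : Type*} (s : Finset ι)
    (c : ι → K) (y : ι → V) (hq : ∀ i, q (y i) = 0)
    (hp : ∀ i j, QuadraticMap.polar q (y i) (y j) = 0) : q (∑ i ∈ s, c i • y i) = 0 := by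
  classical
  induction s using Finset.induction_on with
  | empty => simp
  | insert a s ha ih =>
    have h : q.polarBilin (c a • y a) (∑ i ∈ s, c i • y i) = 0 := by
      simp [map_sum, hp]
    rw [QuadraticMap.polarBilin_apply_apply] at h
    rw [Finset.sum_insert ha, QuadraticMap.map_add q, h, ih, QuadraticMap.map_smul, hq]
    simp

/-- With an anisotropic part of dimension at most one, spanned by `g`, the isotropy of the reduced
rows says that the reduced matrices are alternating up to the rank one term coming from `g`. -/
theorem isValuatedDeltaMatroid_of_quadratic (ν : AddValuation K (WithTop ℝ)) (hm : m ≤ 1)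
    {q : QuadraticForm K V} (hB : IsWittBasis (QuadraticMap.polar q) q B)
    {L : Submodule K V} (hL : IsIsotropicQuadratic q L)
    {M : Matrix (Fin n) (WittIdx n m) K} (hM : Represents B M L) :
    IsValuatedDeltaMatroid (minorValuation ν M) := by
  refine isValuatedDeltaMatroid_minorValuation ν M fun A hA => ?_
  have hB' : IsWittBasis (fun x y => q.polarBilin x y) q B := hB
  have he : ∀ i, q.polarBilin (B (eIdx i)) (B (eIdx i)) = 0 := fun i => by
    simp [QuadraticMap.polar_self, hB.e_isotropic i]
  have hf : ∀ i, q.polarBilin (B (fIdx i)) (B (fIdx i)) = 0 := fun i => by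
    simp [QuadraticMap.polar_self, hB.f_isotropic i]
  have hq : ∀ (A : Finset (Fin n)) i, q (B (wittCol A i)) = 0 := fun A i => by
    by_cases h : i ∈ A <;> simp [wittCol, h, hB.e_isotropic i, hB.f_isotropic i]
  have hpair : ∀ (A : Finset (Fin n)) i,
      q.polarBilin (B (wittCol A i)) (B (wittCol Aᶜ i)) = 1 := fun A i => by
    by_cases h : i ∈ A
    · simpa [wittCol, h] using hB.pairing i
    · simpa [wittCol, h, QuadraticMap.polar_comm q (B (fIdx i))] using hB.pairing i
  have hpair' : ∀ (A : Finset (Fin n)) i,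
      q.polarBilin (B (wittCol Aᶜ i)) (B (wittCol A i)) = 1 := fun A i => by
    simpa using hpair Aᶜ i
  choose w hw hrow using hM.exists_reduced_row_mem hA
  obtain ⟨g, hg⟩ := exists_generator_anisoPart (B := B) hm
  choose γ hγ using fun i => hg (w i) (hw i)
  refine OffDiagControlled.of_alternating_sub (q g) γ (fun i => ?_) fun i k => ?_
  · have h := hL _ (hrow i)
    have hxw := (hB'.apply_add_anisoPart A (reducedMinorMatrix M A i) i (hw i)).1
    have hxy := hB'.apply_wittCol_sum A Aᶜ (reducedMinorMatrix M A i) i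
    rw [hpair, QuadraticMap.polarBilin_apply_apply, RingHom.id_apply, mul_one] at hxy
    rw [QuadraticMap.polarBilin_apply_apply] at hxw
    rw [QuadraticMap.map_add q, QuadraticMap.map_add q, hxw, hxy, hq,
      QuadraticMap.map_sum_smul_eq_zero q _ _ _ (hq Aᶜ)
        (hB'.apply_wittCol_wittCol he hf Aᶜ), hγ i, QuadraticMap.map_smul, smul_eq_mul] at h
    linear_combination h
  · have h : q.polarBilin _ _ = 0 := hL.isIsotropicForm_polarBilin _ (hrow i) _ (hrow k)
    rw [hB'.apply_reduced_row he hf A _ i k (hw i) (hw k), hpair, hpair', hγ i, hγ k, map_smul,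
      map_smul, LinearMap.smul_apply, QuadraticMap.polarBilin_apply_apply,
      QuadraticMap.polar_self, RingHom.id_apply] at h
    simp only [smul_eq_mul, nsmul_eq_mul] at h
    push_cast at h
    linear_combination h

end WittCoordinates

theorem mainTheorem9 {K : Type*} [Field K] (ν : AddValuation K (WithTop ℝ))
    {V : Type*} [AddCommGroup V] [Module K V] [FiniteDimensional K V] (n m : ℕ)
    (hn : n = Module.finrank K V / 2) (B : Module.Basis (WittIdx n m) K V) :
    -- symplectic forms
    (∀ b : V →ₗ[K] V →ₗ[K] K, b.IsAlt → b.Nondegenerate →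
      wittIndex (IsIsotropicForm fun x y => b x y) = n →
      IsWittBasis (fun x y => b x y) (fun x => b x x) B →
      ∀ L : Submodule K V, Maximal (IsIsotropicForm fun x y => b x y) L →
        (∃ M, Represents B M L) ∧
        ∀ M, Represents B M L → IsValuatedDeltaMatroid (minorValuation ν M)) ∧
    -- quadratic forms
    (∀ q : QuadraticForm K V, IsNondegenerateQuadraticForm q →
      wittIndex (IsIsotropicQuadratic q) = n →
      IsWittBasis (QuadraticMap.polar q) q B →
      ∀ L : Submodule K V, Maximal (IsIsotropicQuadratic q) L →
        (∃ M, Represents B M L) ∧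
        ∀ M, Represents B M L → IsValuatedDeltaMatroid (minorValuation ν M)) ∧
    -- Hermitian forms in even dimension
    (∀ σ : K →+* K, (∀ a, σ (σ a) = a) → σ ≠ RingHom.id K → (∀ a, ν (σ a) = ν a) →
      Even (Module.finrank K V) →
      ∀ b : V →ₗ[K] V →ₛₗ[σ] K, IsHermitianForm b → b.Nondegenerate →
      wittIndex (IsIsotropicForm fun x y => b x y) = n →
      IsWittBasis (fun x y => b x y) (fun x => b x x) B →
      ∀ L : Submodule K V, Maximal (IsIsotropicForm fun x y => b x y) L →
        (∃ M, Represents B M L) ∧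
        ∀ M, Represents B M L → IsValuatedDeltaMatroid (minorValuation ν M)) := by
  have hcard : Module.finrank K V = n + n + m := by
    rw [Module.finrank_eq_card_basis B]
    simp
  have hm : m ≤ 1 := by omega
  refine ⟨?_, ?_, ?_⟩
  · intro b halt _ hwitt hB L hL
    have hm0 : m = 0 := by
      by_contra h
      let k : Fin m := ⟨0, Nat.pos_of_ne_zero h⟩
      exact hB.rest_anisotropic (B (Sum.inr k)) (Submodule.subset_span ⟨k, rfl⟩) (B.ne_zero _)
        (halt _)
    refine ⟨exists_represents B ?_, fun M hM => ?_⟩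
    · rw [finrank_eq_wittIndex_of_maximal b halt.isRefl hL, hwitt]
    · refine isValuatedDeltaMatroid_of_sesquilinear ν hm0 (fun _ => rfl) hB (fun i => halt _)
        (fun i => halt _) (fun i => ?_) hL.prop hM
      rw [← halt.neg, show b (B (eIdx i)) (B (fIdx i)) = 1 from hB.pairing i, ν.map_neg, ν.map_one]
  · intro q _ hwitt hB L hL
    refine ⟨exists_represents B ?_, fun M hM =>
      isValuatedDeltaMatroid_of_quadratic ν hm hB hL.prop hM⟩
    rw [finrank_eq_wittIndex_of_maximal_quadratic q hL, hwitt]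
  · intro σ _ _ hσ heven b hherm _ hwitt hB L hL
    have hm0 : m = 0 := by
      obtain ⟨r, hr⟩ := heven
      omega
    refine ⟨exists_represents B ?_, fun M hM => ?_⟩
    · rw [finrank_eq_wittIndex_of_maximal b (fun x y h => by rw [hherm, h, map_zero]) hL, hwitt]
    · refine isValuatedDeltaMatroid_of_sesquilinear ν hm0 hσ hB hB.e_isotropic hB.f_isotropic
        (fun i => ?_) hL.prop hM
      rw [hherm, hσ, show b (B (eIdx i)) (B (fIdx i)) = 1 from hB.pairing i, ν.map_one]
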